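/- Let $k$ be an infinite field, $R=k[x_1,\dots,x_r]$ the standard graded polynomial ring, and $A=R/I$ an artinian Gorenstein graded $k$-algebra; that is, $I\subset R$ is a homogeneous ideal, $A$ is artinian, and its socle $\{a\in A : x_1a=\dots=x_ra=0\}$ is one-dimensional over $k$. Let $h=(1,h_1,h_2,\dots,h_e)$, $h_d=\dim_k A_d$, be its $h$-vector, where $e$ is the socle degree of $A$ (the largest degree with $A_e\ne 0$), and suppose that $h_1=r$ (so that $h=(1,r,h_2,\dots,h_{e-2},r,1)$ when $e\geq 2$). For positive integers $n$ and $d$, the $d$-binomial expansion of $n$ is the unique expression $$n_{(d)}=\binom{n_d}{d}+\binom{n_{d-1}}{d-1}+\dots+\binom{n_j}{j},\qquad n_d>n_{d-1}>\dots>n_j\ge j\ge 1,$$ and for integers $a,b$ one puts $$\bigl(n_{(d)}\bigr)_a^b=\binom{n_d+b}{d+a}+\binom{n_{d-1}+b}{d-1+a}+\dots+\binom{n_j+b}{j+a},$$ where $\binom{m}{q}=0$ whenever $m<q$ or $q<0$. Then, for every integer $i$ with $1\le i\le \frac e2-1$, $$h_{i+1}\ \ge\ \bigl((h_i)_{(e-i)}\bigr)_{-1}^{-1}+\bigl((h_i)_{(e-i)}\bigr)_{-(e-2i-1)}^{-(e-2i)}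 .$$ -/

import Mathlib

noncomputable section

namespace GorensteinBound

open MvPolynomial

attribute [local instance] MvPolynomial.gradedAlgebra

/-- The degree `d` component `A_d` of the quotient `A = k[x_1, …, x_r] / I`: the classes of the
homogeneous polynomials of degree `d`. -/
def gradedPiece {k : Type*} [Field k] {r : ℕ} (I : Ideal (MvPolynomial (Fin r) k)) (d : ℕ) :
    Submodule k (MvPolynomial (Fin r) k ⧸ I) :=
  (homogeneousSubmodule (Fin r) k d).map (Ideal.Quotient.mkₐ k I).toLinearMap

/-- The Hilbert function `d ↦ dim_k A_d` of `A = k[x_1, …, x_r] / I`. -/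
def hilbertFunction {k : Type*} [Field k] {r : ℕ} (I : Ideal (MvPolynomial (Fin r) k)) (d : ℕ) :
    ℕ :=
  Module.finrank k (gradedPiece I d)

/-- The socle of `A = k[x_1, …, x_r] / I`: the elements of `A` annihilated by the maximal ideal
generated by the variables. -/
def socle {k : Type*} [Field k] {r : ℕ} (I : Ideal (MvPolynomial (Fin r) k)) :
    Submodule k (MvPolynomial (Fin r) k ⧸ I) where
  carrier := {a | ∀ j : Fin r, Ideal.Quotient.mk I (X j) * a = 0}
  zero_mem' := fun _ => mul_zero _
  add_mem' := fun {a b} ha hb j => by rw [mul_add, ha j, hb j, add_zero]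
  smul_mem' := fun c a ha j => by rw [mul_smul_comm, ha j, smul_zero]

/-- `A = k[x_1, …, x_r] / I` is an artinian Gorenstein standard graded `k`-algebra: `I` is
homogeneous, `A` is artinian, and the socle of `A` is one-dimensional over `k`. -/
structure IsArtinianGorenstein {k : Type*} [Field k] {r : ℕ}
    (I : Ideal (MvPolynomial (Fin r) k)) : Prop where
  homogeneous : I.IsHomogeneous (homogeneousSubmodule (Fin r) k)
  artinian : IsArtinianRing (MvPolynomial (Fin r) k ⧸ I)
  finrank_socle : Module.finrank k (socle I) = 1

/-- `(h 0, h 1, …, h e)` is the `h`-vector of `A = k[x_1, …, x_r] / I`: `h` is the Hilbert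
function of `A` and `e` is the last degree in which `A` does not vanish (the socle degree of `A`
when `A` is artinian Gorenstein). -/
structure IsHVector {k : Type*} [Field k] {r : ℕ} (I : Ideal (MvPolynomial (Fin r) k))
    (e : ℕ) (h : ℕ → ℕ) : Prop where
  eq_hilbertFunction : ∀ d, h d = hilbertFunction I d
  last_ne_zero : h e ≠ 0
  eq_zero_of_gt : ∀ d, e < d → h d = 0

/-- The binomial coefficient of two integers, with the convention that it is `0` whenever
`m < q` or `q < 0`. -/
def binom (m q : ℤ) : ℕ :=
  if m < q ∨ q < 0 then 0 else m.toNat.choose q.toNat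

/-- `n = C(N i, i) + C(N (i-1), i-1) + ⋯ + C(N j, j)` with `N i > N (i-1) > ⋯ > N j ≥ j ≥ 1`,
that is, the `i`-binomial expansion of `n`. Only the values `N j, …, N i` matter. -/
structure IsBinomialExpansion (n i j : ℕ) (N : ℕ → ℕ) : Prop where
  one_le : 1 ≤ j
  le_top : j ≤ i
  le_last : j ≤ N j
  lt_succ : ∀ t, j ≤ t → t < i → N t < N (t + 1)
  sum_eq : n = ∑ t ∈ Finset.Icc j i, (N t).choose t

/-- `(n_(i))_a^b = C(N i + b, i + a) + ⋯ + C(N j + b, j + a)`, where `N j, …, N i` are the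
entries of the `i`-binomial expansion of `n`. -/
def shiftedSum (i j : ℕ) (N : ℕ → ℕ) (a b : ℤ) : ℕ :=
  ∑ t ∈ Finset.Icc j i, binom ((N t : ℤ) + b) ((t : ℤ) + a)

/-- Every positive integer has an `i`-binomial expansion for every positive `i`. -/
theorem exists_isBinomialExpansion (i n : ℕ) (hi : 1 ≤ i) (hn : 1 ≤ n) :
    ∃ (j : ℕ) (N : ℕ → ℕ), IsBinomialExpansion n i j N := by
  induction i, hi using Nat.le_induction generalizing n with
  | base => exact ⟨1, fun _ => n, le_rfl, le_rfl, hn, by intros; omega, by simp⟩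
  | succ i hi ih =>
    obtain ⟨m, hm1, hm2, hm3⟩ : ∃ m, i + 1 ≤ m ∧ m.choose (i + 1) ≤ n ∧
        n < (m + 1).choose (i + 1) := by
      have hex : ∃ m, n < (m + 1).choose (i + 1) := by
        refine ⟨n + i, ?_⟩
        have h1 : n + 1 ≤ (n + 1 + i).choose (i + 1) := by
          clear ih hn
          induction n with
          | zero => exact Nat.choose_pos (by omega)
          | succ n ih' =>
            have h2 : (n + 1 + 1 + i).choose (i + 1)
                = (n + 1 + i).choose i + (n + 1 + i).choose (i + 1) := by
              rw [show n + 1 + 1 + i = (n + 1 + i) + 1 by omega, Nat.choose_succ_succ]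
            have h3 : 0 < (n + 1 + i).choose i := Nat.choose_pos (by omega)
            omega
        rw [show n + i + 1 = n + 1 + i by omega]
        omega
      classical
      have hspec := Nat.find_spec hex
      have hge : i + 1 ≤ Nat.find hex := by
        by_contra hlt
        have h4 : (Nat.find hex + 1).choose (i + 1) ≤ (i + 1).choose (i + 1) :=
          Nat.choose_le_choose _ (by omega)
        rw [Nat.choose_self] at h4
        omega
      refine ⟨Nat.find hex, hge, ?_, hspec⟩
      have h5 := Nat.find_min hex (m := Nat.find hex - 1) (by omega)
      rw [show Nat.find hex - 1 + 1 = Nat.find hex by omega] at h5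
      omega
    rcases hm2.eq_or_lt with heq | hlt
    · exact ⟨i + 1, fun _ => m, by omega, le_rfl, hm1, by intros; omega, by simp [heq]⟩
    · obtain ⟨j, N, hN⟩ := ih (n - m.choose (i + 1)) (by omega)
      have hle : (N i).choose i ≤ n - m.choose (i + 1) := by
        rw [hN.sum_eq]
        exact Finset.single_le_sum (f := fun t => (N t).choose t) (fun _ _ => Nat.zero_le _)
          (Finset.mem_Icc.2 ⟨hN.le_top, le_rfl⟩)
      have hNi : N i < m := by
        by_contra hcon
        have h6 : m.choose i ≤ (N i).choose i := Nat.choose_le_choose _ (by omega)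
        rw [Nat.choose_succ_succ'] at hm3
        omega
      have hji := hN.le_top
      refine ⟨j, fun t => if t = i + 1 then m else N t, hN.one_le, by omega, ?_, ?_, ?_⟩
      · have := hN.le_last
        simp only [show j ≠ i + 1 by omega, if_false]
        exact this
      · intro t ht1 ht2
        by_cases hti : t = i
        · subst hti
          simpa using hNi
        · simp only [show t ≠ i + 1 by omega, show t + 1 ≠ i + 1 by omega, if_false]
          exact hN.lt_succ t ht1 (by omega)
      · have hs := hN.sum_eq
        rw [Finset.sum_Icc_succ_top (by omega)]
        have hc : ∑ t ∈ Finset.Icc j i, (if t = i + 1 then m else N t).choose t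
            = ∑ t ∈ Finset.Icc j i, (N t).choose t := by
          refine Finset.sum_congr rfl fun t ht => ?_
          rw [Finset.mem_Icc] at ht
          rw [if_neg (by omega)]
        rw [hc, if_pos rfl]
        omega

end GorensteinBound

end

/-!
Fix a linear functional `φ` on `A` that does not vanish on the socle. The pairings
`A_m × A_{e - m} → k`, `(a, b) ↦ φ (a b)`, are nondegenerate, so `h` is symmetric and, for a linear
form `z`, the maps `z : A_i → A_{i+1}` and `z : A_{e-i-1} → A_{e-i}` have the same rank. If `c` is
the Hilbert function of `A / z A`, this says `h_{i+1} = h_i - c_{e-i} + c_{i+1}`.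

For general `z`, Green's hyperplane restriction theorem gives `c_{e-i} ≤ g`, where
`g = ((h_i)_{(e-i)})_0^{-1}`, and Macaulay's theorem, applied from degree `e - i` down to degree
`i + 1`, bounds `c_{i+1}` below by a function `μ` of `c_{e-i}`. As `n - μ n` is nondecreasing,
`h_{i+1} ≥ (h_i - g) + μ g`, and the two summands are (at least) those of the theorem.
-/

namespace GorensteinBound

/-! ### Green's and Macaulay's functions -/

/-- The leading entry `N_d` of the `d`-binomial expansion of `n`, for `1 ≤ d`. -/
noncomputable def topEntry (d n : ℕ) : ℕ :=
  sSup {p | p.choose d ≤ n}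

/-- Green's function `n ↦ C(N_d - 1, d) + C(N_{d-1} - 1, d - 1) + ⋯`, where
`n = C(N_d, d) + C(N_{d-1}, d-1) + ⋯` is the `d`-binomial expansion of `n`: the bound in degree `d`
for the restriction to a general hyperplane of a Hilbert function with value `n`. The convention
`greenFun 0 n = n` makes the recursion uniform. -/
noncomputable def greenFun : ℕ → ℕ → ℕ
  | 0, n => n
  | d + 1, n =>
    (topEntry (d + 1) n - 1).choose (d + 1) +
      greenFun d (n - (topEntry (d + 1) n).choose (d + 1))

/-- Macaulay's lower bound in degree `d - 1` for a Hilbert function with value `n` in degree `d`,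
that is, `C(N_d - 1, d - 1) + C(N_{d-1} - 1, d - 2) + ⋯` in terms of the `d`-binomial expansion. -/
noncomputable def macaulayFun (d n : ℕ) : ℕ := n - greenFun d n

/-- The lower bound in degree `d` for a Hilbert function with value `n` in degree `d + s`, obtained
by applying Macaulay's bound in degrees `d + s, …, d + 1`. -/
noncomputable def macaulayIter (d : ℕ) : ℕ → ℕ → ℕ
  | 0, n => n
  | s + 1, n => macaulayIter d s (macaulayFun (d + s + 1) n)

theorem topEntry_choose_add {d p ρ : ℕ} (hρ : ρ < p.choose d) :
    topEntry (d + 1) (p.choose (d + 1) + ρ) = p := by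
  refine IsGreatest.csSup_eq ⟨Nat.le_add_right _ _, fun q hq => ?_⟩
  have hlt : q.choose (d + 1) < (p + 1).choose (d + 1) := by
    have hq : q.choose (d + 1) ≤ p.choose (d + 1) + ρ := hq
    rw [Nat.choose_succ_succ']
    omega
  exact Nat.lt_succ_iff.1 ((Nat.choose_mono (d + 1)).reflect_lt hlt)

theorem exists_eq_choose_add (d n : ℕ) :
    ∃ p ρ, d ≤ p ∧ ρ < p.choose d ∧ n = p.choose (d + 1) + ρ := by
  induction n with
  | zero => exact ⟨d, 0, le_rfl, by simp, by simp⟩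
  | succ n ih =>
    obtain ⟨p, ρ, hp, hρ, rfl⟩ := ih
    obtain hlt | hge := lt_or_ge (ρ + 1) (p.choose d)
    · exact ⟨p, ρ + 1, hp, hlt, add_assoc _ _ _⟩
    · refine ⟨p + 1, 0, by omega, Nat.choose_pos (by omega), ?_⟩
      rw [Nat.choose_succ_succ']
      omega

theorem exists_eq_succ_choose_add (d : ℕ) {n : ℕ} (hn : 0 < n) :
    ∃ p ρ, d ≤ p ∧ ρ < (p + 1).choose d ∧ n = (p + 1).choose (d + 1) + ρ := by
  obtain ⟨p, ρ, hp, hρ, rfl⟩ := exists_eq_choose_add d n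
  obtain rfl | hdp := hp.eq_or_lt
  · rw [Nat.choose_self] at hρ
    rw [Nat.choose_succ_self] at hn
    omega
  · obtain ⟨q, rfl⟩ := Nat.exists_eq_add_of_le' (Nat.one_le_of_lt hdp)
    exact ⟨q, ρ, Nat.lt_succ_iff.1 hdp, hρ, rfl⟩

theorem greenFun_zero_right (d : ℕ) : greenFun d 0 = 0 := by
  induction d with
  | zero => rfl
  | succ d ih =>
    have htop : topEntry (d + 1) 0 = d := by
      simpa using topEntry_choose_add (d := d) (p := d) (ρ := 0) (by simp)
    rw [greenFun, htop, Nat.zero_sub, ih, Nat.choose_eq_zero_of_lt (by omega)]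

theorem greenFun_choose_add_of_lt {d p ρ : ℕ} (hρ : ρ < (p + 1).choose d) :
    greenFun (d + 1) ((p + 1).choose (d + 1) + ρ) = p.choose (d + 1) + greenFun d ρ := by
  rw [greenFun, topEntry_choose_add hρ, Nat.add_sub_cancel, Nat.add_sub_cancel_left]

theorem greenFun_choose {d p : ℕ} (hp : d ≤ p + 1) :
    greenFun (d + 1) ((p + 1).choose (d + 1)) = p.choose (d + 1) := by
  simpa [greenFun_zero_right] using greenFun_choose_add_of_lt (ρ := 0) (Nat.choose_pos hp)

theorem greenFun_choose_add {d p ρ : ℕ} (hp : d ≤ p) (hρ : ρ ≤ (p + 1).choose (d + 1)) :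
    greenFun (d + 2) ((p + 1).choose (d + 2) + ρ) = p.choose (d + 2) + greenFun (d + 1) ρ := by
  obtain hlt | rfl := hρ.lt_or_eq
  · exact greenFun_choose_add_of_lt hlt
  · rw [add_comm ((p + 1).choose _), ← Nat.choose_succ_succ', greenFun_choose (by omega),
      greenFun_choose (by omega), Nat.choose_succ_succ', add_comm]

theorem greenFun_one (n : ℕ) : greenFun 1 n = n - 1 := by
  cases n with
  | zero => exact greenFun_zero_right 1
  | succ p => simpa using greenFun_choose (d := 0) (p := p) (Nat.zero_le _)

theorem greenFun_succ_one (d : ℕ) : greenFun (d + 1) 1 = 0 := by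
  simpa using greenFun_choose (d := d) (p := d) (Nat.le_succ d)

theorem greenFun_choose_sub_one {d p : ℕ} (hp : d < p) :
    greenFun (d + 1) ((p + 1).choose (d + 1) - 1) + 1 = p.choose (d + 1) := by
  induction d generalizing p with
  | zero => simp only [zero_add, greenFun_one, Nat.choose_one_right]; omega
  | succ d ih =>
    obtain ⟨q, rfl⟩ := Nat.exists_eq_add_of_le' (Nat.one_le_of_lt hp)
    have hpos : 0 < (q + 1).choose (d + 1) := Nat.choose_pos (by omega)
    have hsplit : (q + 1 + 1).choose (d + 1 + 1) - 1 =
        (q + 1).choose (d + 2) + ((q + 1).choose (d + 1) - 1) := by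
      rw [Nat.choose_succ_succ' (q + 1), add_comm, Nat.add_sub_assoc hpos]
    rw [hsplit, greenFun_choose_add (by omega) (Nat.sub_le _ _), add_assoc, ih (by omega),
      Nat.choose_succ_succ' q, add_comm]

theorem greenFun_le_succ_le (d n : ℕ) :
    greenFun d n ≤ greenFun d (n + 1) ∧ greenFun d (n + 1) ≤ greenFun d n + 1 := by
  induction d generalizing n with
  | zero => simp [greenFun]
  | succ d ih =>
    cases d with
    | zero => simp only [zero_add, greenFun_one]; omega
    | succ d =>
      obtain rfl | hn := Nat.eq_zero_or_pos n
      · simp [greenFun_zero_right, greenFun_succ_one]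
      · obtain ⟨p, ρ, hp, hρ, rfl⟩ := exists_eq_succ_choose_add (d + 1) hn
        rw [add_assoc ((p + 1).choose _), greenFun_choose_add (by omega) hρ.le,
          greenFun_choose_add (by omega) hρ, add_assoc]
        exact (ih ρ).imp (Nat.add_le_add_left · _) (Nat.add_le_add_left · _)

theorem greenFun_mono (d : ℕ) : Monotone (greenFun d) :=
  monotone_nat_of_le_succ fun n => (greenFun_le_succ_le d n).1

theorem greenFun_lt_choose {d p n : ℕ} (hp : d < p) (hn : n < (p + 1).choose (d + 1)) :
    greenFun (d + 1) n < p.choose (d + 1) := by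
  rw [← greenFun_choose_sub_one hp]
  exact Nat.lt_succ_of_le (greenFun_mono (d + 1) (Nat.le_sub_one_of_lt hn))

theorem greenFun_le (d n : ℕ) : greenFun d n ≤ n := by
  induction n with
  | zero => rw [greenFun_zero_right]
  | succ n ih => exact (greenFun_le_succ_le d n).2.trans (Nat.succ_le_succ ih)

theorem macaulayFun_add_greenFun (d n : ℕ) : macaulayFun d n + greenFun d n = n :=
  Nat.sub_add_cancel (greenFun_le d n)

theorem macaulayFun_mono (d : ℕ) : Monotone (macaulayFun d) := by
  refine monotone_nat_of_le_succ fun n => ?_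
  have := macaulayFun_add_greenFun d n
  have := macaulayFun_add_greenFun d (n + 1)
  have := (greenFun_le_succ_le d n).2
  omega

theorem macaulayFun_zero_right (d : ℕ) : macaulayFun d 0 = 0 :=
  Nat.zero_sub _

theorem macaulayFun_choose {d p : ℕ} (hp : d ≤ p + 1) :
    macaulayFun (d + 1) ((p + 1).choose (d + 1)) = p.choose d := by
  rw [macaulayFun, greenFun_choose hp, Nat.choose_succ_succ', Nat.add_sub_cancel]

theorem macaulayFun_choose_add {d p ρ : ℕ} (hp : d ≤ p) (hρ : ρ ≤ (p + 1).choose (d + 1)) :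
    macaulayFun (d + 2) ((p + 1).choose (d + 2) + ρ) =
      p.choose (d + 1) + macaulayFun (d + 1) ρ := by
  have hpascal : (p + 1).choose (d + 2) = p.choose (d + 1) + p.choose (d + 2) :=
    Nat.choose_succ_succ' p (d + 1)
  have := macaulayFun_add_greenFun (d + 1) ρ
  rw [macaulayFun, greenFun_choose_add hp hρ]
  omega

theorem macaulayFun_pos (d : ℕ) {n : ℕ} (hn : 0 < n) : 0 < macaulayFun (d + 1) n := by
  have hone : macaulayFun (d + 1) 1 = 1 := by rw [macaulayFun, greenFun_succ_one]
  exact (hone ▸ one_pos).trans_le (macaulayFun_mono (d + 1) hn)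

theorem greenFun_lt_macaulayFun {d a n : ℕ} (ha : a < macaulayFun (d + 1) n) :
    greenFun d a < macaulayFun (d + 1) (greenFun (d + 1) n + 1) := by
  induction d generalizing a n with
  | zero =>
    have hpos : 0 < macaulayFun 1 (greenFun 1 n + 1) := macaulayFun_pos 0 (Nat.succ_pos _)
    simp only [zero_add, macaulayFun, greenFun_one] at ha hpos ⊢
    rw [greenFun]
    omega
  | succ d ih =>
    have hn : 0 < n := Nat.pos_of_ne_zero fun h => by simp [h, macaulayFun_zero_right] at ha
    obtain ⟨p, ρ, hp, hρ, rfl⟩ := exists_eq_succ_choose_add (d + 1) hn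
    obtain ⟨q, rfl⟩ := Nat.exists_eq_add_of_le' (Nat.one_le_of_lt hp)
    have hGρ : greenFun (d + 1) ρ + 1 ≤ (q + 1).choose (d + 1) :=
      greenFun_lt_choose (by omega) hρ
    have hMρ : macaulayFun (d + 1) ρ ≤ (q + 1).choose d := by
      rw [← macaulayFun_choose (by omega)]
      exact macaulayFun_mono (d + 1) hρ.le
    rw [macaulayFun_choose_add (by omega) hρ.le] at ha
    rw [greenFun_choose_add (by omega) hρ.le, add_assoc ((q + 1).choose _),
      macaulayFun_choose_add (by omega) hGρ]
    obtain hlt | hge := lt_or_ge a ((q + 1).choose (d + 1))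
    · have hGa := greenFun_mono (d + 1) hlt.le
      rw [greenFun_choose (by omega)] at hGa
      exact Nat.lt_add_of_pos_right (macaulayFun_pos d (Nat.succ_pos _)) |>.trans_le' <| by
        simpa using hGa
    · obtain ⟨b, rfl⟩ := Nat.exists_eq_add_of_le hge
      have hb : b < macaulayFun (d + 1) ρ := by omega
      rw [greenFun_choose_add_of_lt (by omega)]
      exact Nat.add_lt_add_left (ih hb) _

theorem le_greenFun_add {d a c : ℕ} (h : c ≤ greenFun d a + greenFun (d + 1) c) :
    c ≤ greenFun (d + 1) (a + c) := by
  by_contra! hlt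
  have hsum := macaulayFun_add_greenFun (d + 1) (a + c)
  have hc := macaulayFun_add_greenFun (d + 1) c
  have hmono := macaulayFun_mono (d + 1) (Nat.succ_le_of_lt hlt)
  have hstrict : greenFun d a < macaulayFun (d + 1) (greenFun (d + 1) (a + c) + 1) :=
    greenFun_lt_macaulayFun (by omega)
  simp only [Nat.succ_eq_add_one] at hmono
  omega

theorem macaulayIter_mono (d s : ℕ) : Monotone (macaulayIter d s) := by
  induction s with
  | zero => exact monotone_id
  | succ s ih => exact ih.comp (macaulayFun_mono _)

theorem add_macaulayIter_le_add (d s : ℕ) {m n : ℕ} (h : m ≤ n) :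
    m + macaulayIter d s n ≤ n + macaulayIter d s m := by
  induction s generalizing m n with
  | zero => exact (add_comm m n).le
  | succ s ih =>
    have := macaulayFun_add_greenFun (d + s + 1) m
    have := macaulayFun_add_greenFun (d + s + 1) n
    have := greenFun_mono (d + s + 1) h
    have := ih (macaulayFun_mono (d + s + 1) h)
    simp only [macaulayIter]
    omega

theorem macaulayIter_le {H : ℕ → ℕ} (hH : ∀ n, macaulayFun (n + 1) (H (n + 1)) ≤ H n) (d s : ℕ) :
    macaulayIter d s (H (d + s)) ≤ H d := by
  induction s with
  | zero => exact le_rfl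
  | succ s ih => exact (macaulayIter_mono d s (hH (d + s))).trans ih

/-! ### Dimensions and ranks -/

section LinearAlgebra

variable {k E F : Type*} [Field k] [AddCommGroup E] [Module k E] [AddCommGroup F] [Module k F]

theorem finrank_map_add_finrank_inf_ker (f : E →ₗ[k] F) (P : Submodule k E)
    [FiniteDimensional k P] :
    Module.finrank k (P.map f) + Module.finrank k (P ⊓ LinearMap.ker f : Submodule k E) =
      Module.finrank k P := by
  rw [← LinearMap.finrank_range_add_finrank_ker (f.domRestrict P), LinearMap.range_domRestrict,
    LinearMap.ker_domRestrict, ← Submodule.map_comap_subtype, Submodule.finrank_map_subtype_eq]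

/-- The dimension of the image of `P` in the quotient by `T`, that is, `dim P / (P ∩ T)`. -/
noncomputable def finrankMod (T P : Submodule k E) : ℕ :=
  Module.finrank k (P.map T.mkQ)

theorem finrankMod_add_finrank_inf (T P : Submodule k E) [FiniteDimensional k P] :
    finrankMod T P + Module.finrank k (P ⊓ T : Submodule k E) = Module.finrank k P := by
  rw [← finrank_map_add_finrank_inf_ker T.mkQ P, T.ker_mkQ, finrankMod]

theorem finrankMod_bot (P : Submodule k E) [FiniteDimensional k P] :
    finrankMod ⊥ P = Module.finrank k P := by
  rw [← finrankMod_add_finrank_inf ⊥ P, inf_bot_eq, finrank_bot, add_zero]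

theorem finrankMod_anti {T T' : Submodule k E} (P : Submodule k E) [FiniteDimensional k P]
    (h : T ≤ T') : finrankMod T' P ≤ finrankMod T P := by
  have := finrankMod_add_finrank_inf T P
  have := finrankMod_add_finrank_inf T' P
  have : Module.finrank k ↥(P ⊓ T) ≤ Module.finrank k ↥(P ⊓ T') :=
    Submodule.finrank_mono (inf_le_inf_left P h)
  omega

theorem finrankMod_eq_zero_iff {T P : Submodule k E} [FiniteDimensional k P] :
    finrankMod T P = 0 ↔ P ≤ T := by
  rw [finrankMod, Submodule.finrank_eq_zero, ← LinearMap.le_ker_iff_map, Submodule.ker_mkQ]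

theorem finrankMod_sup_add {S P : Submodule k E} (T : Submodule k E) [FiniteDimensional k P]
    (h : S ≤ P) : finrankMod (T ⊔ S) P + finrankMod T S = finrankMod T P := by
  have : FiniteDimensional k S := Submodule.finiteDimensional_of_le h
  have hT := finrankMod_add_finrank_inf T P
  have hTS := finrankMod_add_finrank_inf (T ⊔ S) P
  have hS := finrankMod_add_finrank_inf T S
  have hmodular := Submodule.finrank_sup_add_finrank_inf_eq (P ⊓ T) S
  rw [inf_sup_assoc_of_le T h, inf_right_comm, inf_eq_right.2 h] at hmodular
  omega

theorem finrankMod_map (f : E →ₗ[k] F) (P : Submodule k E) (T : Submodule k F) :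
    finrankMod T (P.map f) = finrankMod (T.comap f) P := by
  have hinj : Function.Injective ((T.comap f).mapQ T f le_rfl) := by
    rw [← LinearMap.ker_eq_bot, Submodule.ker_mapQ, Submodule.mkQ_map_self]
  rw [finrankMod, finrankMod, (Submodule.equivMapOfInjective _ hinj _).finrank_eq,
    ← Submodule.map_comp, ← Submodule.map_comp, Submodule.mapQ_mkQ]

theorem finrank_range_flip [FiniteDimensional k E] (f : E →ₗ[k] F →ₗ[k] k) :
    Module.finrank k (LinearMap.range f.flip) = Module.finrank k (LinearMap.range f) := by
  have hf : f = f.flip.dualMap ∘ₗ (Module.evalEquiv k E).toLinearMap := by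
    ext x y
    simp
  conv_rhs => rw [hf, LinearMap.range_comp_of_range_eq_top _ (LinearEquiv.range _)]
  rw [LinearMap.finrank_range_dualMap_eq_finrank_range]

theorem finite_setOf_finrank_range_add_smul_lt [FiniteDimensional k E] (f g : E →ₗ[k] F) :
    {t : k | Module.finrank k (LinearMap.range (f + t • g)) <
      Module.finrank k (LinearMap.range f)}.Finite := by
  obtain ⟨v, hv⟩ := f.rangeRestrict.exists_rightInverse_of_surjective f.range_rangeRestrict
  obtain ⟨p, hp⟩ := (LinearMap.range f).subtype.exists_leftInverse_of_injective
    (Submodule.ker_subtype _)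
  have hfv (x) : f (v x) = x := congrArg Subtype.val (DFunLike.congr_fun hv x)
  have hpx (x : LinearMap.range f) : p x = x := DFunLike.congr_fun hp x
  -- If `f + t • g` vanishes at `v x`, then `x` is an eigenvector of `p ∘ₗ g ∘ₗ v`.
  refine ((Module.End.finite_hasEigenvalue (p ∘ₗ g ∘ₗ v)).preimage
    (f := fun t => (-t)⁻¹) (inv_injective.comp neg_injective).injOn).subset fun t ht => ?_
  obtain ⟨x, hx, hx0⟩ := Submodule.exists_mem_ne_zero_of_ne_bot
    (LinearMap.ker_ne_bot_of_finrank_lt (f := (f + t • g).rangeRestrict ∘ₗ v) ht)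
  have hker : f (v x) + t • g (v x) = 0 := congrArg Subtype.val (LinearMap.mem_ker.1 hx)
  have heq : x = -t • (p ∘ₗ g ∘ₗ v) x := calc
    x = p (f (v x)) := by rw [hfv, hpx]
    _ = -t • p (g (v x)) := by
      rw [eq_neg_of_add_eq_zero_left hker, ← neg_smul, map_smul]
  have ht0 : -t ≠ 0 := fun h => hx0 (by rw [heq, h, zero_smul])
  refine Module.End.hasEigenvalue_of_hasEigenvector (x := x)
    ⟨Module.End.mem_eigenspace_iff.2 ?_, hx0⟩
  nth_rw 2 [heq]
  rw [inv_smul_smul₀ ht0]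

end LinearAlgebra

/-! ### Green's hyperplane restriction theorem -/

section Green

variable {k B : Type*} [Field k] [CommRing B] [Algebra k B]

/-- `J` is the sequence of graded pieces of a homogeneous ideal of the subalgebra of `B` generated
by the space `V` of linear forms. The forms of degree `n` are the elements of `V ^ n`. -/
def IsGradedIdeal (V : Submodule k B) (J : ℕ → Submodule k B) : Prop :=
  ∀ n, V * J n ≤ J (n + 1)

/-- The Hilbert function of the quotient by the graded ideal `J`. -/
noncomputable def quotHilbert (V : Submodule k B) (J : ℕ → Submodule k B) (n : ℕ) : ℕ :=
  finrankMod (J n) (V ^ n)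

/-- The graded pieces of the ideal `J + (z)`, for a linear form `z`. -/
def adjoinForm (V : Submodule k B) (J : ℕ → Submodule k B) (z : B) : ℕ → Submodule k B
  | 0 => J 0
  | n + 1 => J (n + 1) ⊔ (V ^ n).map (LinearMap.mulLeft k z)

/-- The graded pieces of the ideal `J : z`, for a linear form `z`. -/
def colonForm (J : ℕ → Submodule k B) (z : B) (n : ℕ) : Submodule k B :=
  (J (n + 1)).comap (LinearMap.mulLeft k z)

variable {V : Submodule k B} {J : ℕ → Submodule k B} {w z : B}

instance [FiniteDimensional k V] (n : ℕ) : FiniteDimensional k ↥(V ^ n) :=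
  Module.Finite.iff_fg.2 ((Module.Finite.iff_fg.1 ‹_›).pow n)

theorem mul_mem_pow_add {m n : ℕ} {a b : B} (ha : a ∈ V ^ m) (hb : b ∈ V ^ n) :
    a * b ∈ V ^ (m + n) :=
  pow_add V m n ▸ Submodule.mul_mem_mul ha hb

theorem map_mulLeft_pow_le (hz : z ∈ V) (n : ℕ) :
    (V ^ n).map (LinearMap.mulLeft k z) ≤ V ^ (n + 1) := by
  rintro _ ⟨y, hy, rfl⟩
  exact pow_succ' V n ▸ Submodule.mul_mem_mul hz hy

theorem IsGradedIdeal.adjoinForm (hJ : IsGradedIdeal V J) (z : B) :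
    IsGradedIdeal V (adjoinForm V J z) := by
  intro n
  cases n with
  | zero => exact (hJ 0).trans le_sup_left
  | succ n =>
    refine (Submodule.mul_sup _ _ _).trans_le (sup_le_sup (hJ (n + 1)) (Submodule.mul_le.2 ?_))
    rintro v hv _ ⟨y, hy, rfl⟩
    exact ⟨v * y, map_mulLeft_pow_le hv n ⟨y, hy, rfl⟩, mul_left_comm z v y⟩

theorem IsGradedIdeal.colonForm (hJ : IsGradedIdeal V J) (z : B) :
    IsGradedIdeal V (colonForm J z) := by
  refine fun n => Submodule.mul_le.2 fun v hv y hy => ?_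
  rw [GorensteinBound.colonForm, Submodule.mem_comap, LinearMap.mulLeft_apply, mul_left_comm]
  exact hJ (n + 1) (Submodule.mul_mem_mul hv hy)

theorem adjoinForm_right_comm (V : Submodule k B) (J : ℕ → Submodule k B) (w z : B) :
    adjoinForm V (adjoinForm V J w) z = adjoinForm V (adjoinForm V J z) w := by
  ext1 n
  cases n with
  | zero => rfl
  | succ n => exact sup_right_comm _ _ _

theorem adjoinForm_colonForm_le (hz : z ∈ V) (w : B) (n : ℕ) :
    adjoinForm V (colonForm J z) w n ≤ colonForm (adjoinForm V J w) z n := by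
  cases n with
  | zero => exact Submodule.comap_mono le_sup_left
  | succ n =>
    refine sup_le (Submodule.comap_mono le_sup_left) ?_
    rintro _ ⟨y, hy, rfl⟩
    exact Submodule.mem_sup_right
      ⟨z * y, map_mulLeft_pow_le hz n ⟨y, hy, rfl⟩, mul_left_comm w z y⟩

variable [FiniteDimensional k V]

theorem quotHilbert_adjoinForm_add (hz : z ∈ V) (n : ℕ) :
    quotHilbert V (adjoinForm V J z) (n + 1) +
      finrankMod (J (n + 1)) ((V ^ n).map (LinearMap.mulLeft k z)) = quotHilbert V J (n + 1) :=
  finrankMod_sup_add (J (n + 1)) (map_mulLeft_pow_le hz n)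

theorem quotHilbert_adjoinForm_add_colonForm (hz : z ∈ V) (n : ℕ) :
    quotHilbert V (adjoinForm V J z) (n + 1) + quotHilbert V (colonForm J z) n =
      quotHilbert V J (n + 1) := by
  rw [← quotHilbert_adjoinForm_add (J := J) hz n, finrankMod_map]
  rfl

theorem quotHilbert_adjoinForm_le (V : Submodule k B) [FiniteDimensional k V]
    (J : ℕ → Submodule k B) (z : B) (n : ℕ) :
    quotHilbert V (adjoinForm V J z) n ≤ quotHilbert V J n := by
  cases n with
  | zero => exact le_rfl
  | succ n => exact finrankMod_anti _ le_sup_left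

theorem quotHilbert_colonForm_le (hJ : IsGradedIdeal V J) (hz : z ∈ V) (n : ℕ) :
    quotHilbert V (colonForm J z) n ≤ quotHilbert V J n :=
  finrankMod_anti _ fun _ hf => hJ n (Submodule.mul_mem_mul hz hf)

theorem quotHilbert_adjoinForm_succ_le (hz : z ∈ V) (w : B) (n : ℕ) :
    quotHilbert V (adjoinForm V J w) (n + 1) ≤
      quotHilbert V (adjoinForm V (adjoinForm V J z) w) (n + 1) +
        quotHilbert V (adjoinForm V (colonForm J z) w) n := by
  rw [← quotHilbert_adjoinForm_add_colonForm hz n, adjoinForm_right_comm V J w z]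
  exact Nat.add_le_add_left (finrankMod_anti _ (adjoinForm_colonForm_le hz w n)) _

theorem pow_succ_le_of_forall_quotHilbert_le {n : ℕ}
    (h : ∀ z ∈ V, quotHilbert V J (n + 1) ≤ quotHilbert V (adjoinForm V J z) (n + 1)) :
    V ^ (n + 1) ≤ J (n + 1) := by
  rw [pow_succ', Submodule.mul_le]
  intro z hz y hy
  have hzero : finrankMod (J (n + 1)) ((V ^ n).map (LinearMap.mulLeft k z)) = 0 := by
    have := quotHilbert_adjoinForm_add (J := J) hz n
    have := h z hz
    omega
  exact finrankMod_eq_zero_iff.1 hzero ⟨y, hy, rfl⟩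

theorem finite_setOf_quotHilbert_lt_adjoinForm (J : ℕ → Submodule k B) (hz : z ∈ V) (hw : w ∈ V)
    (n : ℕ) :
    {t : k | quotHilbert V (adjoinForm V J z) n <
      quotHilbert V (adjoinForm V J (z + t • w)) n}.Finite := by
  cases n with
  | zero => simp [quotHilbert, adjoinForm]
  | succ n =>
    let μ (y : B) : ↥(V ^ n) →ₗ[k] B ⧸ J (n + 1) :=
      (J (n + 1)).mkQ ∘ₗ LinearMap.mulLeft k y ∘ₗ (V ^ n).subtype
    have hrank {y : B} (hy : y ∈ V) : quotHilbert V (adjoinForm V J y) (n + 1) +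
        Module.finrank k (LinearMap.range (μ y)) = quotHilbert V J (n + 1) := by
      rw [← quotHilbert_adjoinForm_add (J := J) hy, LinearMap.range_comp, LinearMap.range_comp,
        Submodule.range_subtype, finrankMod]
    have hline (t : k) : μ (z + t • w) = μ z + t • μ w := by
      ext y
      simp [μ, add_mul, -Submodule.mkQ_apply]
    refine (finite_setOf_finrank_range_add_smul_lt (μ z) (μ w)).subset fun t ht => ?_
    have hzr := hrank hz
    have htr := hrank (V.add_mem hz (V.smul_mem t hw))
    rw [hline] at htr
    simp only [Set.mem_ofPred_eq] at ht ⊢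
    omega

theorem exists_mem_quotHilbert_adjoinForm_le [Infinite k] (J J' : ℕ → Submodule k B)
    (hz : z ∈ V) (hw : w ∈ V) (m n : ℕ) :
    ∃ y ∈ V, quotHilbert V (adjoinForm V J y) m ≤ quotHilbert V (adjoinForm V J z) m ∧
      quotHilbert V (adjoinForm V J' y) n ≤ quotHilbert V (adjoinForm V J' w) n := by
  have hJ := finite_setOf_quotHilbert_lt_adjoinForm J hz (V.sub_mem hw hz) m
  have hJ' := (finite_setOf_quotHilbert_lt_adjoinForm J' hw (V.sub_mem hz hw) n).preimage
    (f := fun t => 1 - t) sub_right_injective.injOn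
  obtain ⟨t, ht⟩ := (hJ.union hJ').exists_notMem
  simp only [Set.mem_union, Set.mem_preimage, Set.mem_ofPred_eq, not_or, not_lt] at ht
  have hline : w + (1 - t) • (z - w) = z + t • (w - z) := by module
  exact ⟨z + t • (w - z), V.add_mem hz (V.smul_mem t (V.sub_mem hw hz)), ht.1, hline ▸ ht.2⟩

/-- Green's hyperplane restriction theorem. -/
theorem exists_mem_quotHilbert_adjoinForm_le_greenFun [Infinite k] (hJ : IsGradedIdeal V J)
    (n : ℕ) : ∃ z ∈ V, quotHilbert V (adjoinForm V J z) n ≤ greenFun n (quotHilbert V J n) := by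
  induction n generalizing J with
  | zero => exact ⟨0, V.zero_mem, le_rfl⟩
  | succ n ih_degree =>
    induction hH : quotHilbert V J (n + 1) using Nat.strong_induction_on generalizing J with
    | _ H ih_value =>
    subst hH
    obtain ⟨z, hz, hmin⟩ := exists_minimalFor_of_wellFoundedLT (· ∈ V)
      (fun z => quotHilbert V (adjoinForm V J z) (n + 1)) ⟨0, V.zero_mem⟩
    replace hmin {y : B} (hy : y ∈ V) : quotHilbert V (adjoinForm V J z) (n + 1) ≤
        quotHilbert V (adjoinForm V J y) (n + 1) := (le_total _ _).elim id (hmin hy)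
    refine ⟨z, hz, ?_⟩
    obtain hlt | heq := (quotHilbert_adjoinForm_le V J z (n + 1)).lt_or_eq
    · obtain ⟨w₁, hw₁, hcolon⟩ := ih_degree (hJ.colonForm z)
      obtain ⟨w₂, hw₂, hadjoin⟩ := ih_value _ hlt (hJ.adjoinForm z) rfl
      obtain ⟨w, hw, hle₁, hle₂⟩ := exists_mem_quotHilbert_adjoinForm_le (colonForm J z)
        (adjoinForm V J z) hw₁ hw₂ n (n + 1)
      rw [← quotHilbert_adjoinForm_add_colonForm (J := J) hz,
        add_comm (quotHilbert V _ (n + 1))]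
      refine le_greenFun_add ?_
      calc quotHilbert V (adjoinForm V J z) (n + 1)
        _ ≤ quotHilbert V (adjoinForm V J w) (n + 1) := hmin hw
        _ ≤ _ := quotHilbert_adjoinForm_succ_le hz w n
        _ ≤ _ := add_le_add (hle₂.trans hadjoin) (hle₁.trans hcolon)
        _ = _ := add_comm _ _
    · have hle := pow_succ_le_of_forall_quotHilbert_le fun y hy => heq.ge.trans (hmin hy)
      rw [heq, quotHilbert, finrankMod_eq_zero_iff.2 hle]
      exact Nat.zero_le _

/-- Macaulay's theorem on the growth of Hilbert functions, read downwards. -/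
theorem macaulayFun_quotHilbert_le [Infinite k] (hJ : IsGradedIdeal V J) (n : ℕ) :
    macaulayFun (n + 1) (quotHilbert V J (n + 1)) ≤ quotHilbert V J n := by
  obtain ⟨z, hz, hgreen⟩ := exists_mem_quotHilbert_adjoinForm_le_greenFun hJ (n + 1)
  have := quotHilbert_adjoinForm_add_colonForm (J := J) hz n
  have := quotHilbert_colonForm_le hJ hz n
  have := macaulayFun_add_greenFun (n + 1) (quotHilbert V J (n + 1))
  omega

end Green

/-! ### Duality -/

section Duality

variable {k B : Type*} [Field k] [CommRing B] [Algebra k B] {V : Submodule k B} {e : ℕ}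
  {φ : B →ₗ[k] k}

/-- The pairings `(a, b) ↦ φ (a b)` of forms of complementary degrees `m + n = e` are
nondegenerate, where the forms of degree `n` are the elements of `V ^ n`. -/
def IsDualizing (V : Submodule k B) (e : ℕ) (φ : B →ₗ[k] k) : Prop :=
  ∀ ⦃m n⦄, m + n = e → ∀ a ∈ V ^ m, (∀ b ∈ V ^ n, φ (a * b) = 0) → a = 0

/-- The bilinear form `(u, v) ↦ φ (z u v)` on the forms of degrees `m` and `n`. -/
def mulPairing (V : Submodule k B) (φ : B →ₗ[k] k) (z : B) (m n : ℕ) :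
    ↥(V ^ m) →ₗ[k] ↥(V ^ n) →ₗ[k] k :=
  ((LinearMap.mul k B).compr₂ φ).compl₂ (V ^ n).subtype ∘ₗ
    LinearMap.mulLeft k z ∘ₗ (V ^ m).subtype

theorem mulPairing_apply (z : B) {m n : ℕ} (u : ↥(V ^ m)) (v : ↥(V ^ n)) :
    mulPairing V φ z m n u v = φ (z * u * v) :=
  rfl

theorem flip_mulPairing (z : B) (m n : ℕ) :
    (mulPairing V φ z m n).flip = mulPairing V φ z n m := by
  ext u v
  rw [LinearMap.flip_apply, mulPairing_apply, mulPairing_apply, mul_right_comm]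

theorem IsDualizing.ker_mulPairing (hφ : IsDualizing V e φ) {d m n : ℕ} {z : B} (hz : z ∈ V ^ d)
    (he : d + m + n = e) : LinearMap.ker (mulPairing V φ z m n) =
      LinearMap.ker (LinearMap.mulLeft k z ∘ₗ (V ^ m).subtype) := by
  ext u
  rw [LinearMap.mem_ker, LinearMap.mem_ker]
  refine ⟨fun hu => hφ he _ (mul_mem_pow_add hz u.2) fun b hb => ?_, fun hu => ?_⟩
  · exact LinearMap.congr_fun hu ⟨b, hb⟩
  · rw [mulPairing, LinearMap.comp_apply, hu, map_zero]

variable [FiniteDimensional k V]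

theorem IsDualizing.finrank_range_mulPairing (hφ : IsDualizing V e φ) {d m n : ℕ} {z : B}
    (hz : z ∈ V ^ d) (he : d + m + n = e) :
    Module.finrank k (LinearMap.range (mulPairing V φ z m n)) =
      Module.finrank k ((V ^ m).map (LinearMap.mulLeft k z)) := by
  have hpairing := LinearMap.finrank_range_add_finrank_ker (mulPairing V φ z m n)
  have hmul := LinearMap.finrank_range_add_finrank_ker (LinearMap.mulLeft k z ∘ₗ (V ^ m).subtype)
  rw [hφ.ker_mulPairing hz he] at hpairing
  rw [LinearMap.range_comp, Submodule.range_subtype] at hmul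
  omega

theorem IsDualizing.finrank_map_mulLeft (hφ : IsDualizing V e φ) {d m n : ℕ} {z : B}
    (hz : z ∈ V ^ d) (he : d + m + n = e) :
    Module.finrank k ((V ^ m).map (LinearMap.mulLeft k z)) =
      Module.finrank k ((V ^ n).map (LinearMap.mulLeft k z)) := by
  rw [← hφ.finrank_range_mulPairing hz he, ← finrank_range_flip, flip_mulPairing,
    hφ.finrank_range_mulPairing hz (add_right_comm d n m ▸ he)]

theorem IsDualizing.finrank_pow_eq (hφ : IsDualizing V e φ) {m n : ℕ} (he : m + n = e) :
    Module.finrank k ↥(V ^ m) = Module.finrank k ↥(V ^ n) := by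
  have hone : (1 : B) ∈ V ^ 0 := pow_zero V ▸ Submodule.one_le.1 le_rfl
  have hmul := hφ.finrank_map_mulLeft (m := m) (n := n) hone (by omega)
  rwa [LinearMap.mulLeft_one, Submodule.map_id, Submodule.map_id] at hmul

theorem isGradedIdeal_bot (V : Submodule k B) : IsGradedIdeal V fun _ => ⊥ :=
  fun _ => (Submodule.mul_bot V).le

theorem quotHilbert_bot (V : Submodule k B) [FiniteDimensional k V] (n : ℕ) :
    quotHilbert V (fun _ => ⊥) n = Module.finrank k ↥(V ^ n) :=
  finrankMod_bot (V ^ n)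

theorem quotHilbert_adjoinForm_bot_add {z : B} (hz : z ∈ V) (n : ℕ) :
    quotHilbert V (adjoinForm V (fun _ => ⊥) z) (n + 1) +
      Module.finrank k ((V ^ n).map (LinearMap.mulLeft k z)) =
        Module.finrank k ↥(V ^ (n + 1)) := by
  rw [← finrankMod_bot ((V ^ n).map _), quotHilbert_adjoinForm_add (J := fun _ => ⊥) hz,
    quotHilbert_bot]

theorem IsDualizing.macaulay_add_macaulayIter_le [Infinite k] {i s : ℕ}
    (hφ : IsDualizing V (i + (i + 1 + s)) φ) :
    macaulayFun (i + 1 + s) (Module.finrank k ↥(V ^ i)) +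
        macaulayIter (i + 1) s (greenFun (i + 1 + s) (Module.finrank k ↥(V ^ i))) ≤
      Module.finrank k ↥(V ^ (i + 1)) := by
  have hsymm : Module.finrank k ↥(V ^ i) = Module.finrank k ↥(V ^ (i + 1 + s)) :=
    hφ.finrank_pow_eq rfl
  obtain ⟨z, hz, hgreen⟩ :=
    exists_mem_quotHilbert_adjoinForm_le_greenFun (isGradedIdeal_bot V) (i + 1 + s)
  rw [quotHilbert_bot, ← hsymm] at hgreen
  have hrank : Module.finrank k ((V ^ i).map (LinearMap.mulLeft k z)) =
      Module.finrank k ((V ^ (i + s)).map (LinearMap.mulLeft k z)) :=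
    hφ.finrank_map_mulLeft ((pow_one V).symm ▸ hz) (by omega)
  have hlow := quotHilbert_adjoinForm_bot_add hz i
  have hhigh := quotHilbert_adjoinForm_bot_add hz (i + s)
  rw [add_right_comm i s 1, ← hsymm] at hhigh
  have hmacaulay := macaulayIter_le
    (macaulayFun_quotHilbert_le ((isGradedIdeal_bot V).adjoinForm z)) (i + 1) s
  have hmono := add_macaulayIter_le_add (i + 1) s hgreen
  have hsplit := macaulayFun_add_greenFun (i + 1 + s) (Module.finrank k ↥(V ^ i))
  omega

end Duality

/-! ### Binomial expansions -/

section Sums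

variable {d j s : ℕ} {N : ℕ → ℕ}

theorem add_le_add_of_strictMonoOn (hN : StrictMonoOn N (Set.Icc j d)) {u t : ℕ} (hju : j ≤ u)
    (hut : u ≤ t) (htd : t ≤ d) : N u + t ≤ N t + u := by
  induction t, hut using Nat.le_induction with
  | base => exact le_rfl
  | succ t hut ih =>
    have := ih (Nat.le_of_succ_le htd)
    have := hN (Set.mem_Icc.2 ⟨by omega, by omega⟩) (Set.mem_Icc.2 ⟨by omega, htd⟩)
      (Nat.lt_succ_self t)
    omega

theorem sum_choose_lt (hjd : j ≤ d) (hj : j + s ≤ N j) (hN : StrictMonoOn N (Set.Icc j d)) :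
    ∑ t ∈ Finset.Icc j d, (N t + 1).choose (t + s + 1) < (N d + 2).choose (d + s + 1) := by
  induction d, hjd using Nat.le_induction with
  | base =>
    rw [Finset.Icc_self, Finset.sum_singleton, Nat.choose_succ_succ' (N j + 1)]
    exact Nat.lt_add_of_pos_left (Nat.choose_pos (by omega))
  | succ d hjd ih =>
    have hlt : N d < N (d + 1) := hN (Set.mem_Icc.2 ⟨hjd, d.le_succ⟩)
      (Set.mem_Icc.2 ⟨by omega, le_rfl⟩) d.lt_succ_self
    rw [Finset.sum_Icc_succ_top (by omega), Nat.choose_succ_succ' (N (d + 1) + 1)]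
    refine Nat.add_lt_add_right ?_ _
    calc _ < (N d + 2).choose (d + s + 1) :=
          ih (hN.mono (Set.Icc_subset_Icc_right d.le_succ))
      _ ≤ (N (d + 1) + 1).choose (d + 1 + s) := by
          rw [add_right_comm d 1 s]
          exact Nat.choose_le_choose _ (by omega)

theorem macaulayFun_sum_choose (hjd : j ≤ d) (hj : j + s ≤ N j)
    (hN : StrictMonoOn N (Set.Icc j d)) :
    macaulayFun (d + s + 1) (∑ t ∈ Finset.Icc j d, (N t + 1).choose (t + s + 1)) =
      ∑ t ∈ Finset.Icc j d, (N t).choose (t + s) := by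
  induction d, hjd using Nat.le_induction with
  | base => simpa using macaulayFun_choose (d := j + s) (p := N j) (by omega)
  | succ d hjd ih =>
    have hN' := hN.mono (Set.Icc_subset_Icc_right d.le_succ)
    have hlt : N d < N (d + 1) := hN (Set.mem_Icc.2 ⟨hjd, d.le_succ⟩)
      (Set.mem_Icc.2 ⟨by omega, le_rfl⟩) d.lt_succ_self
    have hle : N j + (d + 1) ≤ N (d + 1) + j :=
      add_le_add_of_strictMonoOn hN le_rfl (by omega) le_rfl
    have hρ := (sum_choose_lt hjd hj hN').le.trans
      (Nat.choose_le_choose (d + s + 1) (Nat.succ_le_succ hlt))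
    rw [Finset.sum_Icc_succ_top (by omega), Finset.sum_Icc_succ_top (by omega),
      add_comm (∑ t ∈ _, (N t + 1).choose _), add_right_comm d 1 s,
      macaulayFun_choose_add (by omega) hρ, ih hN', add_comm]

theorem macaulayIter_sum_choose_add (hjd : j ≤ d) (hj : j ≤ N j)
    (hN : StrictMonoOn N (Set.Icc j d)) :
    macaulayIter d s (∑ t ∈ Finset.Icc j d, (N t + s).choose (t + s)) =
      ∑ t ∈ Finset.Icc j d, (N t).choose t := by
  induction s with
  | zero => rfl
  | succ s ih =>
    rw [← ih, macaulayIter]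
    exact congrArg _ (macaulayFun_sum_choose (N := fun t => N t + s) hjd (by omega)
      (hN.add_const s))

theorem macaulayIter_sum_choose (hsj : s ≤ j) (hjd : j ≤ d + s) (hj : j ≤ N j)
    (hN : StrictMonoOn N (Set.Icc j (d + s))) :
    macaulayIter d s (∑ t ∈ Finset.Icc j (d + s), (N t).choose t) =
      ∑ t ∈ Finset.Icc j (d + s), (N t - s).choose (t - s) := by
  obtain ⟨l, rfl⟩ := Nat.exists_eq_add_of_le' hsj
  have hsN {t : ℕ} (ht : t ∈ Set.Icc l d) : s ≤ N (t + s) := by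
    have := add_le_add_of_strictMonoOn hN le_rfl (Nat.add_le_add_right ht.1 s)
      (Nat.add_le_add_right ht.2 s)
    omega
  have hmono : StrictMonoOn (fun t => N (t + s) - s) (Set.Icc l d) := fun t ht u hu htu => by
    have := hN (Set.mem_Icc.2 ⟨Nat.add_le_add_right ht.1 s, Nat.add_le_add_right ht.2 s⟩)
      (Set.mem_Icc.2 ⟨Nat.add_le_add_right hu.1 s, Nat.add_le_add_right hu.2 s⟩)
      (Nat.add_lt_add_right htu s)
    have := hsN ht
    dsimp only
    omega
  rw [← Finset.map_add_right_Icc, Finset.sum_map, Finset.sum_map]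
  simp only [addRightEmbedding_apply, Nat.add_sub_cancel]
  rw [← macaulayIter_sum_choose_add (s := s) (by omega) (by omega) hmono]
  refine congrArg _ (Finset.sum_congr rfl fun t ht => ?_)
  rw [Nat.sub_add_cancel (hsN (Finset.mem_Icc.1 ht))]

end Sums

theorem binom_eq_choose {m q : ℤ} {a b : ℕ} (hm : m = a) (hq : q = b) :
    binom m q = a.choose b := by
  subst hm hq
  unfold binom
  split_ifs with h
  · rw [Nat.choose_eq_zero_of_lt (by omega)]
  · simp

theorem binom_eq_zero {m q : ℤ} (h : m < q ∨ q < 0) : binom m q = 0 :=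
  if_pos h

section Expansion

variable {n d j : ℕ} {N : ℕ → ℕ}

theorem IsBinomialExpansion.strictMonoOn (hN : IsBinomialExpansion n d j N) :
    StrictMonoOn N (Set.Icc j d) :=
  strictMonoOn_of_lt_add_one Set.ordConnected_Icc fun t _ ht ht' => hN.lt_succ t ht.1 ht'.2

theorem IsBinomialExpansion.le_apply (hN : IsBinomialExpansion n d j N) {t : ℕ}
    (ht : t ∈ Finset.Icc j d) : t ≤ N t := by
  obtain ⟨hjt, htd⟩ := Finset.mem_Icc.1 ht
  have := add_le_add_of_strictMonoOn hN.strictMonoOn le_rfl hjt htd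
  have := hN.le_last
  omega

theorem IsBinomialExpansion.macaulayFun_eq (hN : IsBinomialExpansion n d j N) :
    macaulayFun d n = ∑ t ∈ Finset.Icc j d, (N t - 1).choose (t - 1) := by
  obtain ⟨l, rfl⟩ := Nat.exists_eq_add_of_le' (hN.one_le.trans hN.le_top)
  rw [hN.sum_eq]
  exact macaulayIter_sum_choose (s := 1) hN.one_le hN.le_top hN.le_last hN.strictMonoOn

theorem IsBinomialExpansion.greenFun_eq (hN : IsBinomialExpansion n d j N) :
    greenFun d n = ∑ t ∈ Finset.Icc j d, (N t - 1).choose t := by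
  have hpascal : ∑ t ∈ Finset.Icc j d, (N t - 1).choose (t - 1) +
      ∑ t ∈ Finset.Icc j d, (N t - 1).choose t = n := by
    rw [hN.sum_eq, ← Finset.sum_add_distrib]
    refine Finset.sum_congr rfl fun t ht => ?_
    have hpos : 1 ≤ t := hN.one_le.trans (Finset.mem_Icc.1 ht).1
    exact (Nat.choose_eq_choose_pred_add (hpos.trans (hN.le_apply ht)) hpos).symm
  have hsplit := macaulayFun_add_greenFun d n
  rw [hN.macaulayFun_eq] at hsplit
  omega

theorem IsBinomialExpansion.shiftedSum_neg_one (hN : IsBinomialExpansion n d j N) :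
    shiftedSum d j N (-1) (-1) = macaulayFun d n := by
  rw [hN.macaulayFun_eq]
  refine Finset.sum_congr rfl fun t ht => ?_
  have := (Finset.mem_Icc.1 ht).1
  have := hN.one_le
  have := hN.le_apply ht
  exact binom_eq_choose (by omega) (by omega)

theorem shiftedSum_le_macaulayIter {s : ℕ} (hjd : j ≤ d + s + 1)
    (hN : StrictMonoOn N (Set.Icc j (d + s))) :
    shiftedSum (d + s) j N (-s) (-(s + 1)) ≤
      macaulayIter d s (∑ t ∈ Finset.Icc j (d + s), (N t - 1).choose t) := by
  induction hjd using Nat.decreasingInduction with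
  | self => simp [shiftedSum]
  | of_succ j hjd ih =>
    by_cases hj : s ≤ j ∧ j < N j
    · have hlt {t : ℕ} (ht : t ∈ Finset.Icc j (d + s)) : t < N t := by
        have := add_le_add_of_strictMonoOn hN le_rfl (Finset.mem_Icc.1 ht).1 (Finset.mem_Icc.1 ht).2
        omega
      have hpred : StrictMonoOn (fun t => N t - 1) (Set.Icc j (d + s)) := fun t ht u hu htu => by
        have := hN ht hu htu
        have := hlt (Finset.mem_Icc.2 ht)
        dsimp only
        omega
      rw [macaulayIter_sum_choose hj.1 (by omega) (by omega) hpred]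
      refine (Finset.sum_congr rfl fun t ht => ?_).le
      have := (Finset.mem_Icc.1 ht).1
      have := hlt ht
      exact binom_eq_choose (by omega) (by omega)
    · have hzero : binom (N j + -(s + 1)) (j + -s) = 0 := binom_eq_zero (by omega)
      calc shiftedSum (d + s) j N (-s) (-(s + 1))
        _ = shiftedSum (d + s) (j + 1) N (-s) (-(s + 1)) := by
          rw [shiftedSum, shiftedSum, ← Finset.add_sum_Ioc_eq_sum_Icc (by omega), hzero, zero_add,
            Finset.Icc_add_one_left_eq_Ioc]
        _ ≤ macaulayIter d s (∑ t ∈ Finset.Icc (j + 1) (d + s), (N t - 1).choose t) :=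
          ih (hN.mono (Set.Icc_subset_Icc_left j.le_succ))
        _ ≤ _ := macaulayIter_mono d s
          (Finset.sum_le_sum_of_subset (Finset.Icc_subset_Icc_left j.le_succ))

theorem IsBinomialExpansion.shiftedSum_le {s : ℕ} (hN : IsBinomialExpansion n (d + s) j N) :
    shiftedSum (d + s) j N (-s) (-(s + 1)) ≤ macaulayIter d s (greenFun (d + s) n) := by
  rw [hN.greenFun_eq]
  exact shiftedSum_le_macaulayIter (Nat.le_succ_of_le hN.le_top) hN.strictMonoOn

end Expansion

/-! ### Artinian Gorenstein algebras -/

section Gorenstein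

open MvPolynomial

attribute [local instance] MvPolynomial.gradedAlgebra

variable {k : Type*} [Field k] {r : ℕ} {I : Ideal (MvPolynomial (Fin r) k)}

theorem gradedPiece_one_pow (I : Ideal (MvPolynomial (Fin r) k)) (n : ℕ) :
    gradedPiece I 1 ^ n = gradedPiece I n := by
  rw [gradedPiece, gradedPiece, ← Submodule.map_pow, homogeneousSubmodule_one_pow]

instance (n : ℕ) : FiniteDimensional k (gradedPiece I n) := by
  have : FiniteDimensional k (gradedPiece I 1) := by
    rw [gradedPiece, homogeneousSubmodule_one_eq_span_X, Submodule.map_span]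
    exact FiniteDimensional.span_of_finite k ((Set.finite_range _).image _)
  exact gradedPiece_one_pow I n ▸ inferInstance

theorem mk_X_mem_gradedPiece (t : Fin r) : Ideal.Quotient.mk I (X t) ∈ gradedPiece I 1 :=
  ⟨X t, isHomogeneous_X k t, rfl⟩

theorem mul_mem_gradedPiece {a b : MvPolynomial (Fin r) k ⧸ I} {m n : ℕ}
    (ha : a ∈ gradedPiece I m) (hb : b ∈ gradedPiece I n) : a * b ∈ gradedPiece I (m + n) := by
  rw [← gradedPiece_one_pow] at ha hb ⊢
  exact mul_mem_pow_add ha hb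

theorem eq_zero_of_mem_gradedPiece_of_ne (hI : I.IsHomogeneous (homogeneousSubmodule (Fin r) k))
    {a : MvPolynomial (Fin r) k ⧸ I} {m n : ℕ} (hmn : m ≠ n)
    (hm : a ∈ gradedPiece I m) (hn : a ∈ gradedPiece I n) : a = 0 := by
  obtain ⟨f, hf, rfl⟩ := hm
  obtain ⟨g, hg, hfg⟩ := hn
  have hcomp := homogeneousComponent_mem_of_mem hI (Ideal.Quotient.eq.1 hfg.symm) m
  rw [map_sub, homogeneousComponent_of_mem hf, homogeneousComponent_of_mem hg, if_pos rfl,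
    if_neg hmn, sub_zero] at hcomp
  exact Ideal.Quotient.eq_zero_iff_mem.2 hcomp

variable {e : ℕ} {h : ℕ → ℕ}

theorem socle_eq_gradedPiece (hI : IsArtinianGorenstein I) (hh : IsHVector I e h) :
    socle I = gradedPiece I e := by
  have : FiniteDimensional k (socle I) :=
    Module.finite_of_finrank_pos (hI.finrank_socle ▸ one_pos)
  have hbot : gradedPiece I (e + 1) = ⊥ := by
    rw [← Submodule.finrank_eq_zero (R := k), ← hilbertFunction, ← hh.eq_hilbertFunction]
    exact hh.eq_zero_of_gt _ e.lt_succ_self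
  have hle : gradedPiece I e ≤ socle I := fun a ha t => by
    rw [← Submodule.mem_bot k, ← hbot, add_comm e]
    exact mul_mem_gradedPiece (mk_X_mem_gradedPiece t) ha
  refine (Submodule.eq_of_le_of_finrank_le hle ?_).symm
  rw [hI.finrank_socle, ← hilbertFunction, ← hh.eq_hilbertFunction]
  exact Nat.one_le_iff_ne_zero.2 hh.last_ne_zero

theorem eq_zero_of_mul_gradedPiece_eq_zero (hI : IsArtinianGorenstein I) (hh : IsHVector I e h)
    {m n : ℕ} (hmn : m + n = e) {a : MvPolynomial (Fin r) k ⧸ I} (ha : a ∈ gradedPiece I m)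
    (hmul : ∀ b ∈ gradedPiece I n, a * b = 0) : a = 0 := by
  induction n generalizing m a with
  | zero =>
    simpa using hmul 1 ⟨1, isHomogeneous_one _ _, map_one (Ideal.Quotient.mkₐ k I)⟩
  | succ n ih =>
    have hsocle : a ∈ socle I := fun t => by
      have hX := mk_X_mem_gradedPiece (I := I) t
      refine ih (m := 1 + m) (by omega) (mul_mem_gradedPiece hX ha) fun b hb => ?_
      rw [mul_comm _ a, mul_assoc]
      exact hmul _ (add_comm 1 n ▸ mul_mem_gradedPiece hX hb)
    rw [socle_eq_gradedPiece hI hh] at hsocle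
    exact eq_zero_of_mem_gradedPiece_of_ne hI.homogeneous (by omega) ha hsocle

theorem IsArtinianGorenstein.exists_isDualizing (hI : IsArtinianGorenstein I)
    (hh : IsHVector I e h) : ∃ φ, IsDualizing (gradedPiece I 1) e φ := by
  have hfinrank : Module.finrank k (gradedPiece I e) = Module.finrank k k := by
    rw [← socle_eq_gradedPiece hI hh, hI.finrank_socle, Module.finrank_self]
  let E : gradedPiece I e ≃ₗ[k] k := LinearEquiv.ofFinrankEq _ _ hfinrank
  obtain ⟨φ, hφ⟩ := LinearMap.exists_extend E.toLinearMap
  have hinj {c} (hc : c ∈ gradedPiece I e) (h0 : φ c = 0) : c = 0 := by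
    have hE : E ⟨c, hc⟩ = 0 := (LinearMap.congr_fun hφ ⟨c, hc⟩).symm.trans h0
    exact congrArg Subtype.val (E.map_eq_zero_iff.1 hE)
  refine ⟨φ, fun m n hmn a ha hab => ?_⟩
  rw [gradedPiece_one_pow] at ha hab
  exact eq_zero_of_mul_gradedPiece_eq_zero hI hh hmn ha fun b hb =>
    hinj (hmn ▸ mul_mem_gradedPiece ha hb) (hab b hb)

end Gorenstein

end GorensteinBound

theorem theorem2p3_general {k B : Type*} [Field k] [Infinite k] [CommRing B] [Algebra k B]
    {V : Submodule k B} [FiniteDimensional k V] {e : ℕ} {φ : B →ₗ[k] k}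
    (hφ : GorensteinBound.IsDualizing V e φ) {i : ℕ} (hie : 2 * i < e) {j : ℕ} {N : ℕ → ℕ}
    (hN : GorensteinBound.IsBinomialExpansion (Module.finrank k ↥(V ^ i)) (e - i) j N) :
    GorensteinBound.shiftedSum (e - i) j N (-1) (-1) +
      GorensteinBound.shiftedSum (e - i) j N
        (-((e : ℤ) - 2 * (i : ℤ) - 1)) (-((e : ℤ) - 2 * (i : ℤ))) ≤
      Module.finrank k ↥(V ^ (i + 1)) := by
  obtain ⟨s, rfl⟩ : ∃ s, e = i + (i + 1 + s) := ⟨e - 2 * i - 1, by omega⟩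
  rw [Nat.add_sub_cancel_left] at hN ⊢
  rw [show ((i + (i + 1 + s) : ℕ) : ℤ) - 2 * i - 1 = s by omega,
    show ((i + (i + 1 + s) : ℕ) : ℤ) - 2 * i = s + 1 by omega, hN.shiftedSum_neg_one]
  exact (Nat.add_le_add_left hN.shiftedSum_le _).trans hφ.macaulay_add_macaulayIter_le

theorem theorem2p3 {k : Type*} [Field k] [Infinite k] (r e : ℕ)
    (I : Ideal (MvPolynomial (Fin r) k)) (hI : GorensteinBound.IsArtinianGorenstein I)
    (h : ℕ → ℕ) (hh : GorensteinBound.IsHVector I e h) (h_one : h 1 = r)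
    (i : ℕ) (hi : 1 ≤ i) (hie : (i : ℚ) ≤ (e : ℚ) / 2 - 1)
    (j : ℕ) (N : ℕ → ℕ) (hN : GorensteinBound.IsBinomialExpansion (h i) (e - i) j N) :
    h (i + 1) ≥
      GorensteinBound.shiftedSum (e - i) j N (-1) (-1) +
      GorensteinBound.shiftedSum (e - i) j N
        (-((e : ℤ) - 2 * (i : ℤ) - 1)) (-((e : ℤ) - 2 * (i : ℤ))) := by
  obtain ⟨φ, hφ⟩ := hI.exists_isDualizing hh
  have hpow (n : ℕ) : h n = Module.finrank k ↥(GorensteinBound.gradedPiece I 1 ^ n) := by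
    rw [hh.eq_hilbertFunction, GorensteinBound.gradedPiece_one_pow, GorensteinBound.hilbertFunction]
  have hlt : 2 * i < e := by
    have : (2 * i : ℚ) < e := by linarith
    exact_mod_cast this
  rw [hpow] at hN ⊢
  exact theorem2p3_general hφ hlt hN
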